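/- Let $n\in\mathbb N$, regard $n\times n$ matrices as vectors in $\mathbb R^{n^2}$ with the Euclidean (Frobenius) norm, let $\mathcal B$ be the Birkhoff polytope (the set of doubly stochastic matrices) and $\mathcal P\subset\mathcal B$ the set of permutation matrices. Let $x^\star\in\mathcal B$ and $f(x)=\tfrac12\|x-x^\star\|_2^2$. Fully corrective Frank–Wolfe with tolerance $\varepsilon_0\ge 0$ starts from an arbitrary $x_0\in\mathcal P$ with no stored atoms and, for $k=1,2,\dots$, as long as $\|x_{k-1}-x^\star\|_2>\varepsilon_0$, chooses $$p_k\in\mathcal P\cap\operatorname*{arg\,min}_{u\in\mathcal B}\langle\nabla f(x_{k-1}),u\rangle,\qquad (\theta_1,\dots,\theta_k)\in\operatorname*{arg\,min}_{u\ge 0,\ \sum_i u_i=1}\Big\|\sum_{i=1}^k u_ip_i-x^\star\Big\|_2^2,\qquad x_k=\sum_{i=1}^k\theta_ip_i .$$ An $\varepsilon$-approximate decomposition of $x^\star$ consists of permutation matrices $P_i$ and weights $w_i>0$ with $\sum_i w_i\le 1$ and $\|x^\star-\sum_i w_iP_i\|_2\le\varepsilon$. Then: (1) For every run and every computed iterate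 $x_k$, put $\varepsilon=\|x_k-x^\star\|_2$. If $k\ge1$, the permutations $p_1,\dots,p_k$ with those of the weights $\theta_1,\dots,\theta_k$ that are positive form an $\varepsilon$-approximate decomposition of $x^\star$. If $\varepsilon>0$ (and, in the case $k=1$, if moreover $\|x_1-x^\star\|_2\le\|x_0-x^\star\|_2$, which holds whenever the algorithm stops at $k=1$ because the tolerance is met), then $$k\le 8n^3\log\!\big(2n/\varepsilon^2\big).$$ (2) For every tolerance $\varepsilon>0$: from every starting point $x_0\in\mathcal P$ there is a run that reaches $\|x_k-x^\star\|_2\le\varepsilon$, and every run with tolerance $\varepsilon$ has at most $\max\{1,\,8n^3\log(2n/\varepsilon^2)\}$ iterations. -/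

import Mathlib

noncomputable section

namespace FCFW

/-- `ℝ^d` with `d = n²`, coordinates indexed by matrix positions, with the Euclidean norm
(which is the Frobenius norm of the matrix). -/
abbrev Vec (n : ℕ) : Type := EuclideanSpace ℝ (Fin n × Fin n)

/-- The vector form of an `n × n` matrix. -/
def vec {n : ℕ} (X : Matrix (Fin n) (Fin n) ℝ) : Vec n :=
  WithLp.toLp 2 (fun ij => X ij.1 ij.2)

/-- The Birkhoff polytope: doubly stochastic matrices in vector form. -/
def birkhoff (n : ℕ) : Set (Vec n) :=
  vec '' (doublyStochastic ℝ (Fin n) : Set (Matrix (Fin n) (Fin n) ℝ))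

/-- The permutation matrices in vector form. -/
def perms (n : ℕ) : Set (Vec n) :=
  Set.range fun σ : Equiv.Perm (Fin n) => vec (σ.permMatrix ℝ)

/-- The objective `f(x) = (1/2) ‖x - x⋆‖²`. -/
def objective {n : ℕ} (xstar x : Vec n) : ℝ := (1 / 2) * ‖x - xstar‖ ^ 2

/-- `p` may be returned by the linear program "minimize `⟨c, u⟩` over `u` in the Birkhoff
polytope": it is a minimizer and it is a permutation matrix (an extreme point). -/
def IsLPSolution {n : ℕ} (c p : Vec n) : Prop :=
  p ∈ perms n ∧ IsMinOn (fun u : Vec n => inner ℝ c u) (birkhoff n) p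

/-- The product `V_k u`, where the columns of `V_k` are `p 1, …, p k`. -/
def combine {n : ℕ} (p : ℕ → Vec n) (k : ℕ) (u : Fin k → ℝ) : Vec n :=
  ∑ i : Fin k, u i • p (i + 1)

/-- `x 0, …, x K`, `p 1, …, p K` and `θ 1, …, θ K` (with `θ k` the weight vector computed in
iteration `k`) are the data produced by the first `K` iterations of fully corrective Frank-Wolfe
with target `xstar` and tolerance `tol`, started with no stored atoms. The algorithm need not
have stopped after `K` iterations, so that every cap on the number of iterations is covered. -/
structure IsRun {n : ℕ} (xstar : Vec n) (tol : ℝ) (K : ℕ)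
    (x p : ℕ → Vec n) (θ : (k : ℕ) → Fin k → ℝ) : Prop where
  /-- The starting point is a permutation matrix. -/
  init : x 0 ∈ perms n
  /-- An iteration is executed only while the error exceeds the tolerance. -/
  guard : ∀ k < K, tol < ‖x k - xstar‖
  /-- The new permutation solves the linear program given by the gradient. -/
  lp : ∀ k < K, IsLPSolution (gradient (objective xstar) (x k)) (p (k + 1))
  /-- The weights are taken in the simplex, -/
  simplex : ∀ k < K, θ (k + 1) ∈ stdSimplex ℝ (Fin (k + 1))
  /-- and are optimal there. -/
  optimal : ∀ k < K, IsMinOn (fun u : Fin (k + 1) → ℝ => ‖combine p (k + 1) u - xstar‖ ^ 2)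
    (stdSimplex ℝ (Fin (k + 1))) (θ (k + 1))
  /-- The new iterate. -/
  iterate : ∀ k < K, x (k + 1) = combine p (k + 1) (θ (k + 1))

/-- The permutations `P i` with the positive weights `w i`, for `i ∈ S`, form an `ε`-approximate
decomposition of `xstar`. -/
def IsApproxDecomposition {n : ℕ} (xstar : Vec n) (ε : ℝ) {ι : Type*} (S : Finset ι)
    (P : ι → Vec n) (w : ι → ℝ) : Prop :=
  (∀ i ∈ S, P i ∈ perms n) ∧ (∀ i ∈ S, 0 < w i) ∧ ∑ i ∈ S, w i ≤ 1 ∧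
    ‖xstar - ∑ i ∈ S, w i • P i‖ ≤ ε

end FCFW

end

/-!
Let `B` be the Birkhoff polytope and `G = ⟪x - x⋆, x - p⟫` the Frank–Wolfe gap at an iterate `x`,
where `p` is the permutation chosen next. Since the next iterate is at least as good as every point
of the segment from `x` to `p`, and `B` has squared diameter at most `2n`, one iteration lowers the
squared error by at least `G² / (2n)`.

The gap dominates the error. Moving from `x` to `x⋆` inside `B` amounts to taking a total weight `s`
off the active atoms and putting it on a single doubly stochastic matrix `z`; as the atoms are
`0`-`1` vectors, taking weight off an atom lowers all entries of its support at once, so that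
`s ≤ ∑ₑ (xₑ - x⋆ₑ)⁺ ≤ (n / 2) ‖x - x⋆‖` suffices. Full correction makes `⟪x - x⋆, ·⟫` take the same
value at all active atoms as at `x`, and `p` minimizes it over `B`; hence `‖x - x⋆‖² ≤ s G`, that is
`‖x - x⋆‖ ≤ (n / 2) G`, and the squared error contracts by the factor `1 - 2 / n³`.

The first iterate has discarded `x₀`, so it need not be better than `x₀`. However,
`‖x₀ - x⋆‖² + ‖x₁ - x⋆‖² ≤ 2n` and `‖x₂ - x⋆‖² ≤ n / 2`, which is what the logarithm needs to absorb
the first two iterations.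
-/

namespace FCFW

open Set
open scoped InnerProductSpace

section ConvexMinimization

variable {E : Type*} [NormedAddCommGroup E] [InnerProductSpace ℝ E]

theorem inner_sub_nonneg_of_isMinOn_norm {s : Set E} {x y w : E} (hs : Convex ℝ s)
    (hmin : IsMinOn (fun u => ‖u - y‖) s x) (hx : x ∈ s) (hw : w ∈ s) :
    0 ≤ ⟪x - y, w - x⟫_ℝ := by
  have hinf : ‖y - x‖ = ⨅ u : s, ‖y - u‖ := by
    simpa only [norm_sub_rev y] using (hmin.iInf_eq hx).symm
  have hinner := (norm_eq_iInf_iff_real_inner_le_zero hs hx).1 hinf w hw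
  rw [← neg_sub x y, inner_neg_left] at hinner
  exact neg_nonpos.1 hinner

theorem inner_eq_inner_self_of_isMinOn_norm_convexHull {ι : Type*} [Fintype ι] {q : ι → E}
    {θ : ι → ℝ} {x y : E} (hθ : θ ∈ stdSimplex ℝ ι) (hx : ∑ i, θ i • q i = x)
    (hmin : IsMinOn (fun u => ‖u - y‖) (convexHull ℝ (range q)) x) {i : ι} (hi : θ i ≠ 0) :
    ⟪x - y, q i⟫_ℝ = ⟪x - y, x⟫_ℝ := by
  have hq : ∀ j, q j ∈ convexHull ℝ (range q) := fun j =>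
    subset_convexHull ℝ _ (mem_range_self j)
  have hxmem : x ∈ convexHull ℝ (range q) :=
    hx ▸ (convex_convexHull ℝ _).sum_mem (fun j _ => hθ.1 j) hθ.2 fun j _ => hq j
  have hnonneg : ∀ j, 0 ≤ θ j * ⟪x - y, q j - x⟫_ℝ := fun j =>
    mul_nonneg (hθ.1 j)
      (inner_sub_nonneg_of_isMinOn_norm (convex_convexHull ℝ _) hmin hxmem (hq j))
  have hsum : ∑ j, θ j * ⟪x - y, q j - x⟫_ℝ = 0 := by
    simp only [← inner_smul_right, ← inner_sum, smul_sub, Finset.sum_sub_distrib,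
      ← Finset.sum_smul, hθ.2, hx, one_smul, sub_self, inner_zero_right]
  have hterm := (Finset.sum_eq_zero_iff_of_nonneg fun j _ => hnonneg j).1 hsum i (Finset.mem_univ i)
  rw [← sub_eq_zero, ← inner_sub_right]
  exact (mul_eq_zero.1 hterm).resolve_left hi

theorem exists_mem_segment_norm_sub_sq_le {x y p : E} {D : ℝ} (hD : ‖x - p‖ ^ 2 ≤ D)
    (hgap : ⟪x - y, x - p⟫_ℝ ∈ Icc 0 D) :
    ∃ w ∈ segment ℝ x p, ‖w - y‖ ^ 2 ≤ ‖x - y‖ ^ 2 - ⟪x - y, x - p⟫_ℝ ^ 2 / D := by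
  set G : ℝ := ⟪x - y, x - p⟫_ℝ
  -- the minimizer over `γ` of the upper bound `‖x - y‖² - 2 γ G + γ² D`
  set γ : ℝ := G / D with hγ
  have hD0 : 0 ≤ D := hgap.1.trans hgap.2
  have hγD : γ * D = G := div_mul_cancel_of_imp fun h => le_antisymm (h ▸ hgap.2) hgap.1
  refine ⟨x - γ • (x - p), ⟨1 - γ, γ, sub_nonneg.2 (div_le_one_of_le₀ hgap.2 hD0),
    div_nonneg hgap.1 hD0, sub_add_cancel _ _, by module⟩, ?_⟩
  calc ‖x - γ • (x - p) - y‖ ^ 2 = ‖x - y - γ • (x - p)‖ ^ 2 := by rw [sub_right_comm]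
    _ = ‖x - y‖ ^ 2 - 2 * γ * G + γ ^ 2 * ‖x - p‖ ^ 2 := by
      rw [norm_sub_sq_real, inner_smul_right, norm_smul, mul_pow, Real.norm_eq_abs, sq_abs]
      ring
    _ ≤ ‖x - y‖ ^ 2 - 2 * γ * G + γ ^ 2 * D := by gcongr
    _ = ‖x - y‖ ^ 2 - G ^ 2 / D := by
      rw [show G ^ 2 / D = γ * G by rw [hγ]; ring]
      linear_combination γ * hγD

end ConvexMinimization

section CoordinateSums

variable {ι κ : Type*} [Fintype ι] [Fintype κ]

theorem sum_posPart_le_of_sum_eq_zero {g : EuclideanSpace ℝ κ} (hg : ∑ e, g e = 0) :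
    ∑ e, (g e)⁺ ≤ √(Fintype.card κ) / 2 * ‖g‖ := by
  have hposPart : ∀ a : ℝ, a⁺ = (|a| + a) / 2 := fun a => by
    linarith [posPart_add_negPart a, posPart_sub_negPart a]
  have habs : ∑ e, |g e| ≤ √(Fintype.card κ) * ‖g‖ := by
    refine le_of_sq_le_sq ?_ (by positivity)
    rw [mul_pow, Real.sq_sqrt (Nat.cast_nonneg _), EuclideanSpace.real_norm_sq_eq]
    simpa using sq_sum_le_card_mul_sum_sq (s := Finset.univ) (f := fun e => |g e|)
  simp only [hposPart, ← Finset.sum_div, Finset.sum_add_distrib, hg]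
  linarith

theorem exists_weights_sub_le_sum {q : ι → κ → ℝ} {θ : ι → ℝ} {x y : κ → ℝ}
    (hq : ∀ i e, q i e = 0 ∨ q i e = 1) (hθ : ∀ i, 0 ≤ θ i) (hx : ∀ e, ∑ i, θ i * q i e = x e)
    (hy : ∀ e, 0 ≤ y e) :
    ∃ δ : ι → ℝ, (∀ i, 0 ≤ δ i) ∧ (∀ i, θ i = 0 → δ i = 0) ∧ ∑ i, δ i = ∑ e, (x e - y e)⁺ ∧
      ∀ e, x e - y e ≤ ∑ i, δ i * q i e := by
  have hq0 : ∀ i e, 0 ≤ q i e := fun i e => by rcases hq i e with h | h <;> simp [h]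
  have hqq : ∀ i e, q i e * q i e = q i e := fun i e => by rcases hq i e with h | h <;> simp [h]
  have hx0 : ∀ e, 0 ≤ x e := fun e =>
    hx e ▸ Finset.sum_nonneg fun i _ => mul_nonneg (hθ i) (hq0 i e)
  set r : κ → ℝ := fun e => (x e - y e)⁺ / x e
  have hr0 : ∀ e, 0 ≤ r e := fun e => div_nonneg (posPart_nonneg _) (hx0 e)
  have hrx : ∀ e, r e * x e = (x e - y e)⁺ := fun e =>
    div_mul_cancel_of_imp fun h => posPart_eq_zero.2 (by linarith [hy e])
  refine ⟨fun i => θ i * ∑ e, q i e * r e, fun i => ?_, fun i hi => ?_, ?_, fun e => ?_⟩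
  · exact mul_nonneg (hθ i) (Finset.sum_nonneg fun e _ => mul_nonneg (hq0 i e) (hr0 e))
  · exact mul_eq_zero_of_left hi _
  · simp only [Finset.mul_sum]
    rw [Finset.sum_comm]
    refine Finset.sum_congr rfl fun e _ => ?_
    rw [← hrx, ← hx, Finset.mul_sum]
    exact Finset.sum_congr rfl fun i _ => by ring
  · calc x e - y e ≤ r e * x e := (le_posPart _).trans_eq (hrx e).symm
      _ = ∑ i, θ i * (q i e * r e) * q i e := by
        rw [← hx, Finset.mul_sum]
        refine Finset.sum_congr rfl fun i _ => ?_
        linear_combination (-r e * θ i) * hqq i e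
      _ ≤ ∑ i, θ i * (∑ e', q i e' * r e') * q i e := by
        gcongr with i
        · exact hq0 i e
        · exact hθ i
        · exact Finset.single_le_sum (f := fun e' => q i e' * r e')
            (fun e' _ => mul_nonneg (hq0 i e') (hr0 e')) (Finset.mem_univ e)

end CoordinateSums

section Birkhoff

variable {n : ℕ}

theorem birkhoff_eq_convexHull_perms : birkhoff n = convexHull ℝ (perms n) := by
  have hvec : IsLinearMap ℝ (vec (n := n)) := ⟨fun _ _ => rfl, fun _ _ => rfl⟩
  rw [birkhoff, doublyStochastic_eq_convexHull_permMatrix, hvec.image_convexHull]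
  exact congrArg _ (range_comp vec _).symm

theorem convex_birkhoff : Convex ℝ (birkhoff n) :=
  birkhoff_eq_convexHull_perms ▸ convex_convexHull ℝ _

theorem perms_subset_birkhoff : perms n ⊆ birkhoff n :=
  birkhoff_eq_convexHull_perms ▸ subset_convexHull ℝ _

theorem apply_eq_zero_or_one_of_mem_perms {p : Vec n} (hp : p ∈ perms n) (e : Fin n × Fin n) :
    p e = 0 ∨ p e = 1 := by
  obtain ⟨σ, rfl⟩ := hp
  simp only [vec, Equiv.Perm.permMatrix, PEquiv.toMatrix_apply]
  split_ifs <;> simp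

theorem mem_birkhoff_iff {u : Vec n} : u ∈ birkhoff n ↔
    (∀ e, 0 ≤ u e) ∧ (∀ i, ∑ j, u (i, j) = 1) ∧ ∀ j, ∑ i, u (i, j) = 1 := by
  constructor
  · rintro ⟨X, hX, rfl⟩
    obtain ⟨hnonneg, hrow, hcol⟩ := mem_doublyStochastic_iff_sum.1 hX
    exact ⟨fun e => hnonneg e.1 e.2, hrow, hcol⟩
  · rintro ⟨hnonneg, hrow, hcol⟩
    exact ⟨fun i j => u (i, j),
      mem_doublyStochastic_iff_sum.2 ⟨fun i j => hnonneg (i, j), hrow, hcol⟩, rfl⟩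

theorem exists_mem_birkhoff_eq_smul {w : Vec n} {s : ℝ} (hs : 0 ≤ s) (hnonneg : ∀ e, 0 ≤ w e)
    (hrow : ∀ i, ∑ j, w (i, j) = s) (hcol : ∀ j, ∑ i, w (i, j) = s) :
    ∃ z ∈ birkhoff n, w = s • z := by
  obtain ⟨X, hX, hwX⟩ := (exists_mem_doublyStochastic_eq_smul_iff (M := fun i j => w (i, j)) hs).2
    ⟨fun i j => hnonneg (i, j), hrow, hcol⟩
  refine ⟨vec X, mem_image_of_mem vec hX, ?_⟩
  ext e
  exact congrFun₂ hwX e.1 e.2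

theorem sum_apply_of_mem_birkhoff {u : Vec n} (hu : u ∈ birkhoff n) : ∑ e, u e = n := by
  simp [Fintype.sum_prod_type, (mem_birkhoff_iff.1 hu).2.1]

theorem apply_le_one_of_mem_birkhoff {u : Vec n} (hu : u ∈ birkhoff n) (e : Fin n × Fin n) :
    u e ≤ 1 := by
  obtain ⟨hnonneg, hrow, -⟩ := mem_birkhoff_iff.1 hu
  rw [← hrow e.1]
  exact Finset.single_le_sum (f := fun j => u (e.1, j)) (fun j _ => hnonneg _)
    (Finset.mem_univ e.2)

theorem inner_nonneg_of_mem_birkhoff {u v : Vec n} (hu : u ∈ birkhoff n) (hv : v ∈ birkhoff n) :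
    0 ≤ ⟪u, v⟫_ℝ := by
  rw [PiLp.inner_apply]
  exact Finset.sum_nonneg fun e _ =>
    mul_nonneg ((mem_birkhoff_iff.1 hv).1 e) ((mem_birkhoff_iff.1 hu).1 e)

theorem norm_sq_le_of_mem_birkhoff {u : Vec n} (hu : u ∈ birkhoff n) : ‖u‖ ^ 2 ≤ n := by
  rw [EuclideanSpace.real_norm_sq_eq, ← sum_apply_of_mem_birkhoff hu]
  exact Finset.sum_le_sum fun e _ =>
    pow_le_of_le_one ((mem_birkhoff_iff.1 hu).1 e) (apply_le_one_of_mem_birkhoff hu e) two_ne_zero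

theorem norm_sub_sq_le_of_mem_birkhoff {u v : Vec n} (hu : u ∈ birkhoff n)
    (hv : v ∈ birkhoff n) : ‖u - v‖ ^ 2 ≤ 2 * n := by
  rw [norm_sub_sq_real]
  linarith [norm_sq_le_of_mem_birkhoff hu, norm_sq_le_of_mem_birkhoff hv,
    inner_nonneg_of_mem_birkhoff hu hv]

theorem two_le_of_birkhoff_nontrivial (h : (birkhoff n).Nontrivial) : 2 ≤ n := by
  by_contra! hn
  have : Subsingleton (Fin n) := Fin.subsingleton_iff_le_one.2 (by omega)
  refine not_subsingleton_iff.2 h fun u hu v hv => ?_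
  ext ⟨i, j⟩
  have hentry : ∀ w ∈ birkhoff n, w (i, j) = 1 := fun w hw => by
    rw [← (mem_birkhoff_iff.1 hw).2.1 i, Fintype.sum_subsingleton _ j]
  rw [hentry u hu, hentry v hv]

theorem exists_sub_eq_sum_smul_sub_smul {ι : Type*} [Fintype ι] {q : ι → Vec n} {θ : ι → ℝ}
    {x y : Vec n} (hq : ∀ i, q i ∈ perms n) (hθ : θ ∈ stdSimplex ℝ ι) (hx : ∑ i, θ i • q i = x)
    (hy : y ∈ birkhoff n) :
    ∃ δ : ι → ℝ, ∃ z ∈ birkhoff n, (∀ i, 0 ≤ δ i) ∧ (∀ i, θ i = 0 → δ i = 0) ∧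
      ∑ i, δ i ≤ n / 2 * ‖x - y‖ ∧ x - y = ∑ i, δ i • q i - (∑ i, δ i) • z := by
  have hqB : ∀ i, q i ∈ birkhoff n := fun i => perms_subset_birkhoff (hq i)
  have hxB : x ∈ birkhoff n :=
    hx ▸ convex_birkhoff.sum_mem (fun i _ => hθ.1 i) hθ.2 fun i _ => hqB i
  obtain ⟨-, hxrow, hxcol⟩ := mem_birkhoff_iff.1 hxB
  obtain ⟨hy0, hyrow, hycol⟩ := mem_birkhoff_iff.1 hy
  obtain ⟨δ, hδ0, hδθ, hδsum, hδle⟩ := exists_weights_sub_le_sum (q := fun i e => q i e)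
    (x := x) (y := y) (fun i => apply_eq_zero_or_one_of_mem_perms (hq i)) hθ.1
    (fun e => by simp [← hx]) hy0
  set w : Vec n := y - x + ∑ i, δ i • q i with hw
  have hwe : ∀ e, w e = y e - x e + ∑ i, δ i * q i e := fun e => by simp [w]
  have hrow : ∀ a, ∑ b, w (a, b) = ∑ i, δ i := fun a => by
    simp only [hwe, Finset.sum_add_distrib, Finset.sum_sub_distrib, hxrow, hyrow]
    rw [Finset.sum_comm]
    simp [← Finset.mul_sum, (mem_birkhoff_iff.1 (hqB _)).2.1]
  have hcol : ∀ b, ∑ a, w (a, b) = ∑ i, δ i := fun b => by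
    simp only [hwe, Finset.sum_add_distrib, Finset.sum_sub_distrib, hxcol, hycol]
    rw [Finset.sum_comm]
    simp [← Finset.mul_sum, (mem_birkhoff_iff.1 (hqB _)).2.2]
  obtain ⟨z, hz, hwz⟩ := exists_mem_birkhoff_eq_smul (Finset.sum_nonneg fun i _ => hδ0 i)
    (fun e => by linarith [hwe e, hδle e]) hrow hcol
  refine ⟨δ, z, hz, hδ0, hδθ, ?_, by rw [← hwz, hw]; abel⟩
  have hsum : ∑ e, (x - y) e = 0 := by
    simp [sum_apply_of_mem_birkhoff hxB, sum_apply_of_mem_birkhoff hy]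
  simpa [hδsum] using sum_posPart_le_of_sum_eq_zero hsum

theorem norm_sub_le_mul_inner_of_isMinOn {ι : Type*} [Fintype ι] {q : ι → Vec n} {θ : ι → ℝ}
    {x y v : Vec n} (hq : ∀ i, q i ∈ perms n) (hθ : θ ∈ stdSimplex ℝ ι)
    (hx : ∑ i, θ i • q i = x) (hmin : IsMinOn (fun u => ‖u - y‖) (convexHull ℝ (range q)) x)
    (hy : y ∈ birkhoff n) (hv : IsMinOn (fun u => ⟪x - y, u⟫_ℝ) (birkhoff n) v) :
    ‖x - y‖ ≤ n / 2 * ⟪x - y, x - v⟫_ℝ := by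
  obtain ⟨δ, z, hz, hδ0, hδθ, hδle, hxy⟩ := exists_sub_eq_sum_smul_sub_smul hq hθ hx hy
  have hatom : ∀ i, δ i * ⟪x - y, q i⟫_ℝ = δ i * ⟪x - y, x⟫_ℝ := fun i => by
    by_cases hi : θ i = 0
    · simp [hδθ i hi]
    · rw [inner_eq_inner_self_of_isMinOn_norm_convexHull hθ hx hmin hi]
  have hxB : x ∈ birkhoff n :=
    hx ▸ convex_birkhoff.sum_mem (fun i _ => hθ.1 i) hθ.2 fun i _ => perms_subset_birkhoff (hq i)
  have hgap : 0 ≤ ⟪x - y, x - v⟫_ℝ := by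
    rw [inner_sub_right]
    exact sub_nonneg.2 (hv hxB)
  have hsq : ‖x - y‖ * ‖x - y‖ ≤ ‖x - y‖ * (n / 2 * ⟪x - y, x - v⟫_ℝ) :=
    calc ‖x - y‖ * ‖x - y‖ = ⟪x - y, ∑ i, δ i • q i - (∑ i, δ i) • z⟫_ℝ := by
          rw [← hxy, real_inner_self_eq_norm_mul_norm]
      _ = (∑ i, δ i) * (⟪x - y, x⟫_ℝ - ⟪x - y, z⟫_ℝ) := by
          simp only [inner_sub_right, inner_sum, inner_smul_right, hatom, ← Finset.sum_mul, mul_sub]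
      _ ≤ (∑ i, δ i) * ⟪x - y, x - v⟫_ℝ := by
          rw [inner_sub_right]
          exact mul_le_mul_of_nonneg_left (sub_le_sub_left (hv hz) _)
            (Finset.sum_nonneg fun i _ => hδ0 i)
      _ ≤ n / 2 * ‖x - y‖ * ⟪x - y, x - v⟫_ℝ := mul_le_mul_of_nonneg_right hδle hgap
      _ = ‖x - y‖ * (n / 2 * ⟪x - y, x - v⟫_ℝ) := by ring
  rcases (norm_nonneg (x - y)).eq_or_lt with hzero | hpos
  · rw [← hzero]
    positivity
  · exact le_of_mul_le_mul_left hsq hpos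

end Birkhoff

section Subproblems

variable {n : ℕ}

theorem gradient_objective (xstar x : Vec n) : gradient (objective xstar) x = x - xstar := by
  refine HasGradientAt.gradient (hasGradientAt_iff_hasFDerivAt.2 ?_)
  refine (((hasFDerivAt_id (𝕜 := ℝ) x).sub_const xstar).norm_sq.const_mul (1 / 2)).congr_fderiv ?_
  ext u
  simp

theorem exists_isLPSolution (c : Vec n) : ∃ p, IsLPSolution c p := by
  obtain ⟨σ, hσ⟩ := Finite.exists_min fun σ : Equiv.Perm (Fin n) => ⟪c, vec (σ.permMatrix ℝ)⟫_ℝ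
  refine ⟨_, mem_range_self σ, fun u hu => ?_⟩
  obtain ⟨_, ⟨τ, rfl⟩, hτ⟩ :=
    ((innerₗ (Vec n) c).concaveOn convex_univ).exists_le_of_mem_convexHull (subset_univ _)
      (birkhoff_eq_convexHull_perms ▸ hu)
  exact (hσ τ).trans hτ

/-- The polytope spanned by the atoms `p 1, …, p k`, over which iteration `k` of fully corrective
Frank–Wolfe minimizes. -/
def atomHull (p : ℕ → Vec n) (k : ℕ) : Set (Vec n) :=
  convexHull ℝ (range fun i : Fin k => p (i + 1))

theorem atomHull_mono (p : ℕ → Vec n) : Monotone (atomHull p) := by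
  refine fun k l hkl => convexHull_mono ?_
  rintro _ ⟨i, rfl⟩
  exact ⟨i.castLE hkl, rfl⟩

theorem mem_atomHull (p : ℕ → Vec n) {k l : ℕ} (hkl : k < l) : p (k + 1) ∈ atomHull p l :=
  subset_convexHull ℝ _ ⟨⟨k, hkl⟩, rfl⟩

theorem combine_image_stdSimplex (p : ℕ → Vec n) (k : ℕ) :
    combine p k '' stdSimplex ℝ (Fin k) = atomHull p k := by
  have hlin : combine p k = Fintype.linearCombination ℝ fun i : Fin k => p (i + 1) := rfl
  rw [hlin, ← convexHull_rangle_single_eq_stdSimplex, LinearMap.image_convexHull, ← range_comp,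
    atomHull]
  congr! with i
  simp

theorem exists_optimal_weights (xstar : Vec n) (p : ℕ → Vec n) (k : ℕ) :
    ∃ t ∈ stdSimplex ℝ (Fin (k + 1)),
      IsMinOn (fun u : Fin (k + 1) → ℝ => ‖combine p (k + 1) u - xstar‖ ^ 2)
        (stdSimplex ℝ (Fin (k + 1))) t := by
  refine (isCompact_stdSimplex ℝ (Fin (k + 1))).exists_isMinOn
    ⟨_, single_mem_stdSimplex ℝ 0⟩ (Continuous.continuousOn ?_)
  unfold combine
  fun_prop

end Subproblems

section Logarithm

theorem le_mul_log_of_le_mul_exp {s A c m : ℝ} (hs : 0 < s) (hA : 0 < A) (hc : 0 < c)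
    (h : s ≤ A * Real.exp (-(m / c))) : m ≤ c * Real.log (A / s) := by
  rw [← div_le_iff₀' hc, Real.le_log_iff_exp_le (by positivity), le_div_iff₀ hs]
  calc Real.exp (m / c) * s ≤ Real.exp (m / c) * (A * Real.exp (-(m / c))) := by gcongr
    _ = A * (Real.exp (m / c) * Real.exp (-(m / c))) := by ring
    _ = A := by rw [← Real.exp_add, add_neg_cancel, Real.exp_zero, mul_one]

theorem add_two_le_mul_log_of_le_mul_exp {n : ℕ} (hn : 2 ≤ n) {s m : ℝ} (hs : 0 < s)
    (h : s ≤ n * Real.exp (-(m / (n ^ 3 / 2)))) :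
    m + 2 ≤ n ^ 3 / 2 * Real.log (2 * n / s) := by
  have hn3 : (4 : ℝ) ≤ n ^ 3 / 2 := by
    have : (2 : ℝ) ^ 3 ≤ n ^ 3 := by gcongr; exact_mod_cast hn
    linarith
  have hn0 : (0 : ℝ) < n := by positivity
  have hm := le_mul_log_of_le_mul_exp hs hn0 (by positivity) h
  have htwo : 2 ≤ n ^ 3 / 2 * Real.log 2 := by nlinarith [Real.log_two_gt_d9]
  rw [mul_div_assoc, Real.log_mul two_ne_zero (by positivity), mul_add]
  linarith

end Logarithm

namespace IsRun

variable {n : ℕ} {xstar : Vec n} {tol : ℝ} {K : ℕ} {x p : ℕ → Vec n} {θ : (k : ℕ) → Fin k → ℝ}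

theorem atom_mem_perms (h : IsRun xstar tol K x p θ) {k : ℕ} (hk : k < K) :
    p (k + 1) ∈ perms n :=
  (h.lp k hk).1

theorem isMinOn_inner_atom (h : IsRun xstar tol K x p θ) {k : ℕ} (hk : k < K) :
    IsMinOn (fun u => ⟪x k - xstar, u⟫_ℝ) (birkhoff n) (p (k + 1)) :=
  gradient_objective xstar (x k) ▸ (h.lp k hk).2

theorem iterate_mem_atomHull (h : IsRun xstar tol K x p θ) {k : ℕ} (hk : k < K) :
    x (k + 1) ∈ atomHull p (k + 1) := by
  rw [h.iterate k hk, ← combine_image_stdSimplex]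
  exact mem_image_of_mem _ (h.simplex k hk)

theorem isMinOn_norm_iterate (h : IsRun xstar tol K x p θ) {k : ℕ} (hk : k < K) :
    IsMinOn (fun u => ‖u - xstar‖) (atomHull p (k + 1)) (x (k + 1)) := by
  rw [h.iterate k hk, ← combine_image_stdSimplex]
  rintro _ ⟨u, hu, rfl⟩
  exact le_of_sq_le_sq (h.optimal k hk hu) (norm_nonneg _)

theorem iterate_mem_birkhoff (h : IsRun xstar tol K x p θ) {k : ℕ} (hk : k ≤ K) :
    x k ∈ birkhoff n := by
  rcases k with _ | k
  · exact perms_subset_birkhoff h.init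
  · refine convexHull_min ?_ convex_birkhoff (h.iterate_mem_atomHull hk)
    rintro _ ⟨i, rfl⟩
    exact perms_subset_birkhoff (h.atom_mem_perms (by omega))

theorem inner_sub_atom_nonneg (h : IsRun xstar tol K x p θ) {k : ℕ} (hk : k < K) :
    0 ≤ ⟪x k - xstar, x k - p (k + 1)⟫_ℝ := by
  rw [inner_sub_right]
  exact sub_nonneg.2 (h.isMinOn_inner_atom hk (h.iterate_mem_birkhoff hk.le))

theorem norm_sub_sq_le_sub_inner_sq (h : IsRun xstar tol K x p θ) (hstar : xstar ∈ birkhoff n)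
    {k : ℕ} (hk : k + 1 < K) :
    ‖x (k + 2) - xstar‖ ^ 2 ≤ ‖x (k + 1) - xstar‖ ^ 2 -
      ⟪x (k + 1) - xstar, x (k + 1) - p (k + 2)⟫_ℝ ^ 2 / (2 * n) := by
  have hx := h.iterate_mem_birkhoff hk.le
  have hstep := norm_sub_sq_le_of_mem_birkhoff hx (perms_subset_birkhoff (h.atom_mem_perms hk))
  have hgap : ⟪x (k + 1) - xstar, x (k + 1) - p (k + 2)⟫_ℝ ≤ 2 * n := by
    have herror := norm_sub_sq_le_of_mem_birkhoff hx hstar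
    have hcs := real_inner_le_norm (x (k + 1) - xstar) (x (k + 1) - p (k + 2))
    linarith [two_mul_le_add_sq ‖x (k + 1) - xstar‖ ‖x (k + 1) - p (k + 2)‖]
  obtain ⟨w, hw, hwle⟩ :=
    exists_mem_segment_norm_sub_sq_le hstep ⟨h.inner_sub_atom_nonneg hk, hgap⟩
  have hwhull : w ∈ atomHull p (k + 2) :=
    (convex_convexHull ℝ _).segment_subset
      (atomHull_mono p (k + 1).le_succ (h.iterate_mem_atomHull (by omega)))
      (mem_atomHull p (k + 1).lt_succ_self) hw
  exact (pow_le_pow_left₀ (norm_nonneg _) (h.isMinOn_norm_iterate hk hwhull) 2).trans hwle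

theorem norm_sub_le_mul_inner (h : IsRun xstar tol K x p θ) (hstar : xstar ∈ birkhoff n)
    {k : ℕ} (hk : k + 1 < K) :
    ‖x (k + 1) - xstar‖ ≤ n / 2 * ⟪x (k + 1) - xstar, x (k + 1) - p (k + 2)⟫_ℝ :=
  have hk' : k < K := by omega
  norm_sub_le_mul_inner_of_isMinOn (fun i => h.atom_mem_perms (by omega)) (h.simplex k hk')
    (h.iterate k hk').symm (h.isMinOn_norm_iterate hk') hstar (h.isMinOn_inner_atom hk)

theorem norm_sub_sq_le_mul (h : IsRun xstar tol K x p θ) (hstar : xstar ∈ birkhoff n)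
    {k : ℕ} (hk : k + 1 < K) :
    ‖x (k + 2) - xstar‖ ^ 2 ≤ ‖x (k + 1) - xstar‖ ^ 2 * (1 - 2 / n ^ 3) := by
  have hprogress := h.norm_sub_sq_le_sub_inner_sq hstar hk
  have hgap := pow_le_pow_left₀ (norm_nonneg _) (h.norm_sub_le_mul_inner hstar hk) 2
  set G : ℝ := ⟪x (k + 1) - xstar, x (k + 1) - p (k + 2)⟫_ℝ
  calc ‖x (k + 2) - xstar‖ ^ 2 ≤ ‖x (k + 1) - xstar‖ ^ 2 - G ^ 2 / (2 * n) := hprogress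
    _ = ‖x (k + 1) - xstar‖ ^ 2 - (n / 2 * G) ^ 2 * (2 / n ^ 3) := by
      rcases n.eq_zero_or_pos with rfl | hn
      · simp
      · field_simp
    _ ≤ ‖x (k + 1) - xstar‖ ^ 2 - ‖x (k + 1) - xstar‖ ^ 2 * (2 / n ^ 3) := by gcongr
    _ = ‖x (k + 1) - xstar‖ ^ 2 * (1 - 2 / n ^ 3) := by ring

theorem norm_iterate_zero_sub_sq_add_norm_iterate_one_sub_sq_le (h : IsRun xstar tol K x p θ)
    (hstar : xstar ∈ birkhoff n) (hK : 0 < K) :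
    ‖x 0 - xstar‖ ^ 2 + ‖x 1 - xstar‖ ^ 2 ≤ 2 * n := by
  have hx1 : x 1 = p 1 := by simpa [atomHull] using h.iterate_mem_atomHull hK
  have hx0B := h.iterate_mem_birkhoff K.zero_le
  have hx1B := h.iterate_mem_birkhoff (k := 1) hK
  have hlp : ⟪x 0 - xstar, x 1⟫_ℝ ≤ ⟪x 0 - xstar, xstar⟫_ℝ := by
    rw [hx1]
    exact h.isMinOn_inner_atom hK hstar
  rw [inner_sub_left, inner_sub_left, real_inner_self_eq_norm_sq, real_inner_comm] at hlp
  rw [norm_sub_sq_real, norm_sub_sq_real]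
  linarith [norm_sq_le_of_mem_birkhoff hx0B, norm_sq_le_of_mem_birkhoff hx1B,
    inner_nonneg_of_mem_birkhoff hx1B hx0B, real_inner_comm xstar (x 1)]

theorem norm_iterate_two_sub_sq_le (h : IsRun xstar tol K x p θ) (hstar : xstar ∈ birkhoff n)
    (hn : 0 < n) (hK : 1 < K) : ‖x 2 - xstar‖ ^ 2 ≤ n / 2 := by
  have hgap : ‖x 1 - xstar‖ ^ 2 ≤ ⟪x 1 - xstar, x 1 - p 2⟫_ℝ := by
    rw [← real_inner_self_eq_norm_sq, inner_sub_right, inner_sub_right]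
    exact sub_le_sub_left (h.isMinOn_inner_atom hK hstar) _
  calc ‖x 2 - xstar‖ ^ 2 ≤ ‖x 1 - xstar‖ ^ 2 - ⟪x 1 - xstar, x 1 - p 2⟫_ℝ ^ 2 / (2 * n) :=
        h.norm_sub_sq_le_sub_inner_sq hstar hK
    _ ≤ ‖x 1 - xstar‖ ^ 2 - (‖x 1 - xstar‖ ^ 2) ^ 2 / (2 * n) := by gcongr
    _ = n / 2 - (‖x 1 - xstar‖ ^ 2 - n) ^ 2 / (2 * n) := by
      field_simp
      ring
    _ ≤ n / 2 := sub_le_self _ (by positivity)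

theorem norm_iterate_sub_sq_le_exp (h : IsRun xstar tol K x p θ) (hstar : xstar ∈ birkhoff n)
    (hn : 2 ≤ n) {k : ℕ} (hk : 1 ≤ k) (hkK : k < K) :
    ‖x (k + 1) - xstar‖ ^ 2 ≤ n * Real.exp (-(k / (n ^ 3 / 2))) := by
  have hexp : 1 - 2 / (n : ℝ) ^ 3 ≤ Real.exp (-(1 / (n ^ 3 / 2))) := by
    linarith [Real.add_one_le_exp (-(1 / ((n : ℝ) ^ 3 / 2))), one_div_div ((n : ℝ) ^ 3) 2]
  induction k, hk using Nat.le_induction with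
  | base =>
    have hn3 : 2 / (n : ℝ) ^ 3 ≤ 1 / 2 := by
      have : (2 : ℝ) ^ 3 ≤ n ^ 3 := by gcongr; exact_mod_cast hn
      rw [div_le_div_iff₀ (by positivity) two_pos]
      linarith
    calc ‖x 2 - xstar‖ ^ 2 ≤ n * (1 / 2) :=
          (h.norm_iterate_two_sub_sq_le hstar (by omega) hkK).trans_eq (by ring)
      _ ≤ n * Real.exp (-((1 : ℕ) / (n ^ 3 / 2))) := by
          rw [Nat.cast_one]
          gcongr
          linarith
  | succ k _ ih =>
    calc ‖x (k + 2) - xstar‖ ^ 2 ≤ ‖x (k + 1) - xstar‖ ^ 2 * (1 - 2 / n ^ 3) :=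
          h.norm_sub_sq_le_mul hstar hkK
      _ ≤ ‖x (k + 1) - xstar‖ ^ 2 * Real.exp (-(1 / (n ^ 3 / 2))) := by gcongr
      _ ≤ n * Real.exp (-(k / (n ^ 3 / 2))) * Real.exp (-(1 / (n ^ 3 / 2))) := by
          gcongr
          exact ih (by omega)
      _ = n * Real.exp (-((k + 1 : ℕ) / (n ^ 3 / 2))) := by
          rw [mul_assoc, ← Real.exp_add]
          congr 2
          push_cast
          ring

theorem add_two_le_mul_log (h : IsRun xstar tol K x p θ) (hstar : xstar ∈ birkhoff n) {k : ℕ}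
    (hk : k < K) {ε : ℝ} (hε : 0 < ε) (hzero : k = 0 → ε ≤ ‖x 0 - xstar‖)
    (herror : ε ≤ ‖x (k + 1) - xstar‖) :
    (k : ℝ) + 2 ≤ n ^ 3 / 2 * Real.log (2 * n / ε ^ 2) := by
  have hne : x (k + 1) ≠ xstar := sub_ne_zero.1 (norm_pos_iff.1 (hε.trans_le herror))
  have hn : 2 ≤ n :=
    two_le_of_birkhoff_nontrivial ⟨_, h.iterate_mem_birkhoff hk, _, hstar, hne⟩
  refine add_two_le_mul_log_of_le_mul_exp hn (sq_pos_of_pos hε) ?_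
  have hsq := pow_le_pow_left₀ hε.le herror 2
  rcases k.eq_zero_or_pos with rfl | hkpos
  · have hsq0 := pow_le_pow_left₀ hε.le (hzero rfl) 2
    have hsum := h.norm_iterate_zero_sub_sq_add_norm_iterate_one_sub_sq_le hstar hk
    simp only [Nat.cast_zero, zero_div, neg_zero, Real.exp_zero, mul_one]
    linarith
  · exact hsq.trans (h.norm_iterate_sub_sq_le_exp hstar hn hkpos hk)

theorem length_le_of_error_pos (h : IsRun xstar tol K x p θ) (hstar : xstar ∈ birkhoff n)
    (hpos : 0 < ‖x K - xstar‖) (hone : K = 1 → ‖x 1 - xstar‖ ≤ ‖x 0 - xstar‖) :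
    (K : ℝ) ≤ n ^ 3 / 2 * Real.log (2 * n / ‖x K - xstar‖ ^ 2) := by
  rcases K with _ | k
  · have hdiam := norm_sub_sq_le_of_mem_birkhoff (h.iterate_mem_birkhoff le_rfl) hstar
    have hlog := Real.log_nonneg ((one_le_div (by positivity)).2 hdiam)
    rw [Nat.cast_zero]
    positivity
  · have := h.add_two_le_mul_log hstar k.lt_succ_self hpos
      (fun hk => by subst hk; exact hone rfl) le_rfl
    push_cast
    linarith

theorem length_le_of_tolerance_pos (h : IsRun xstar tol K x p θ) (hstar : xstar ∈ birkhoff n)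
    (htol : 0 < tol) : (K : ℝ) ≤ max 1 (n ^ 3 / 2 * Real.log (2 * n / tol ^ 2)) := by
  rcases K with _ | _ | k
  · simp
  · simp
  · refine le_max_of_le_right ?_
    exact_mod_cast h.add_two_le_mul_log hstar (by omega : k < k + 2) htol
      (fun _ => (h.guard 0 (by omega)).le) (h.guard (k + 1) (by omega)).le

theorem isApproxDecomposition (h : IsRun xstar tol K x p θ) (hK : 1 ≤ K) :
    IsApproxDecomposition xstar ‖x K - xstar‖
      (Finset.univ.filter fun i : Fin K => 0 < θ K i) (fun i => p (i + 1)) (θ K) := by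
  obtain ⟨k, rfl⟩ := Nat.exists_eq_add_of_le' hK
  obtain ⟨hθ0, hθ1⟩ := h.simplex k k.lt_succ_self
  have hcombine : ∑ i with 0 < θ (k + 1) i, θ (k + 1) i • p (i + 1) = x (k + 1) := by
    rw [h.iterate k k.lt_succ_self]
    exact Finset.sum_filter_of_ne fun i _ hi => (hθ0 i).lt_of_ne' (left_ne_zero_of_smul hi)
  refine ⟨fun i _ => h.atom_mem_perms i.2, fun i hi => (Finset.mem_filter.1 hi).2, ?_, ?_⟩
  · rw [← hθ1]
    exact Finset.sum_le_univ_sum_of_nonneg hθ0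
  · rw [hcombine, norm_sub_rev]

theorem congr {x' p' : ℕ → Vec n} {θ' : (k : ℕ) → Fin k → ℝ} (h : IsRun xstar tol K x p θ)
    (hx : ∀ k ≤ K, x' k = x k) (hp : ∀ k ≤ K, p' k = p k) (hθ : ∀ k ≤ K, θ' k = θ k) :
    IsRun xstar tol K x' p' θ' := by
  have hcombine : ∀ k < K, combine p' (k + 1) = combine p (k + 1) := fun k hk => by
    funext u
    exact Finset.sum_congr rfl fun i _ => by rw [hp (i + 1) (by omega)]
  refine ⟨hx 0 K.zero_le ▸ h.init, fun k hk => ?_, fun k hk => ?_, fun k hk => ?_,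
    fun k hk => ?_, fun k hk => ?_⟩
  · exact hx k hk.le ▸ h.guard k hk
  · exact hx k hk.le ▸ hp (k + 1) hk ▸ h.lp k hk
  · exact hθ (k + 1) hk ▸ h.simplex k hk
  · exact hθ (k + 1) hk ▸ hcombine k hk ▸ h.optimal k hk
  · rw [hx _ hk, hθ _ hk, hcombine k hk, h.iterate k hk]

theorem succ (h : IsRun xstar tol K x p θ) (hguard : tol < ‖x K - xstar‖)
    (hlp : IsLPSolution (gradient (objective xstar) (x K)) (p (K + 1)))
    (hsimplex : θ (K + 1) ∈ stdSimplex ℝ (Fin (K + 1)))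
    (hoptimal : IsMinOn (fun u : Fin (K + 1) → ℝ => ‖combine p (K + 1) u - xstar‖ ^ 2)
      (stdSimplex ℝ (Fin (K + 1))) (θ (K + 1)))
    (hiterate : x (K + 1) = combine p (K + 1) (θ (K + 1))) :
    IsRun xstar tol (K + 1) x p θ where
  init := h.init
  guard := Nat.forall_lt_succ_right.2 ⟨h.guard, hguard⟩
  lp := Nat.forall_lt_succ_right.2 ⟨h.lp, hlp⟩
  simplex := Nat.forall_lt_succ_right.2 ⟨h.simplex, hsimplex⟩
  optimal := Nat.forall_lt_succ_right.2 ⟨h.optimal, hoptimal⟩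
  iterate := Nat.forall_lt_succ_right.2 ⟨h.iterate, hiterate⟩

theorem exists_succ (h : IsRun xstar tol K x p θ) (hguard : tol < ‖x K - xstar‖) :
    ∃ (x' p' : ℕ → Vec n) (θ' : (k : ℕ) → Fin k → ℝ),
      IsRun xstar tol (K + 1) x' p' θ' ∧ x' 0 = x 0 := by
  obtain ⟨v, hv⟩ := exists_isLPSolution (gradient (objective xstar) (x K))
  set p' := Function.update p (K + 1) v
  obtain ⟨t, ht, hmin⟩ := exists_optimal_weights xstar p' K
  set θ' := Function.update θ (K + 1) t
  set x' := Function.update x (K + 1) (combine p' (K + 1) t)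
  have hagree : ∀ k ≤ K, x' k = x k ∧ p' k = p k ∧ θ' k = θ k := fun k hk =>
    have hne : k ≠ K + 1 := by omega
    ⟨Function.update_of_ne hne .., Function.update_of_ne hne .., Function.update_of_ne hne ..⟩
  have hrun : IsRun xstar tol K x' p' θ' := h.congr (fun k hk => (hagree k hk).1)
    (fun k hk => (hagree k hk).2.1) fun k hk => (hagree k hk).2.2
  have hxK : x' K = x K := (hagree K le_rfl).1
  have hpnew : p' (K + 1) = v := Function.update_self ..
  have hθnew : θ' (K + 1) = t := Function.update_self ..
  have hxnew : x' (K + 1) = combine p' (K + 1) t := Function.update_self ..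
  refine ⟨x', p', θ', hrun.succ ?_ ?_ ?_ ?_ ?_, (hagree 0 K.zero_le).1⟩
  · rwa [hxK]
  · rwa [hxK, hpnew]
  · rwa [hθnew]
  · rwa [hθnew]
  · rw [hxnew, hθnew]

end IsRun

theorem exists_isRun_norm_sub_le {n : ℕ} {xstar x₀ : Vec n} (hstar : xstar ∈ birkhoff n)
    (hx₀ : x₀ ∈ perms n) {ε : ℝ} (hε : 0 < ε) :
    ∃ (K : ℕ) (x p : ℕ → Vec n) (θ : (k : ℕ) → Fin k → ℝ),
      IsRun xstar ε K x p θ ∧ x 0 = x₀ ∧ ‖x K - xstar‖ ≤ ε := by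
  by_contra! hfar
  have hlong : ∀ K : ℕ, ∃ (x p : ℕ → Vec n) (θ : (k : ℕ) → Fin k → ℝ),
      IsRun xstar ε K x p θ ∧ x 0 = x₀ := fun K => by
    induction K with
    | zero => exact ⟨fun _ => x₀, fun _ => x₀, fun _ _ => 0, ⟨hx₀, by simp, by simp, by simp,
        by simp, by simp⟩, rfl⟩
    | succ K ih =>
      obtain ⟨x, p, θ, h, h0⟩ := ih
      obtain ⟨x', p', θ', h', h0'⟩ := h.exists_succ (hfar K x p θ h h0)
      exact ⟨x', p', θ', h', h0'.trans h0⟩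
  obtain ⟨K, hK⟩ := exists_nat_gt (max 1 ((n : ℝ) ^ 3 / 2 * Real.log (2 * n / ε ^ 2)))
  obtain ⟨x, p, θ, h, -⟩ := hlong K
  exact hK.not_ge (h.length_le_of_tolerance_pos hstar hε)

end FCFW

theorem mainTheorem5_general (n : ℕ) (xstar : FCFW.Vec n) (hxstar : xstar ∈ FCFW.birkhoff n) :
    (∀ (tol : ℝ) (K : ℕ) (x p : ℕ → FCFW.Vec n) (θ : (k : ℕ) → Fin k → ℝ),
      FCFW.IsRun xstar tol K x p θ →
        (1 ≤ K → FCFW.IsApproxDecomposition xstar ‖x K - xstar‖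
          (Finset.univ.filter fun i : Fin K => 0 < θ K i) (fun i => p (i + 1)) (θ K)) ∧
        (0 < ‖x K - xstar‖ → (K = 1 → ‖x 1 - xstar‖ ≤ ‖x 0 - xstar‖) →
          (K : ℝ) ≤ (n : ℝ) ^ 3 / 2 * Real.log (2 * n / ‖x K - xstar‖ ^ 2))) ∧
    (∀ ε : ℝ, 0 < ε →
      (∀ x₀ ∈ FCFW.perms n, ∃ (K : ℕ) (x p : ℕ → FCFW.Vec n) (θ : (k : ℕ) → Fin k → ℝ),
        FCFW.IsRun xstar ε K x p θ ∧ x 0 = x₀ ∧ ‖x K - xstar‖ ≤ ε) ∧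
      (∀ (K : ℕ) (x p : ℕ → FCFW.Vec n) (θ : (k : ℕ) → Fin k → ℝ),
        FCFW.IsRun xstar ε K x p θ →
          (K : ℝ) ≤ max 1 ((n : ℝ) ^ 3 / 2 * Real.log (2 * n / ε ^ 2)))) :=
  ⟨fun _ _ _ _ _ h => ⟨h.isApproxDecomposition, h.length_le_of_error_pos hxstar⟩,
    fun _ hε => ⟨fun _ hx₀ => FCFW.exists_isRun_norm_sub_le hxstar hx₀ hε,
      fun _ _ _ _ h => h.length_le_of_tolerance_pos hxstar hε⟩⟩

theorem mainTheorem5 (n : ℕ) (xstar : FCFW.Vec n) (hxstar : xstar ∈ FCFW.birkhoff n) :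
    -- error attained after `K` iterations, for every run
    (∀ (tol : ℝ) (K : ℕ) (x p : ℕ → FCFW.Vec n) (θ : (k : ℕ) → Fin k → ℝ),
      0 ≤ tol → FCFW.IsRun xstar tol K x p θ →
        (1 ≤ K → FCFW.IsApproxDecomposition xstar ‖x K - xstar‖
          (Finset.univ.filter fun i : Fin K => 0 < θ K i) (fun i => p (i + 1)) (θ K)) ∧
        (0 < ‖x K - xstar‖ → (K = 1 → ‖x 1 - xstar‖ ≤ ‖x 0 - xstar‖) →
          (K : ℝ) ≤ 8 * (n : ℝ) ^ 3 * Real.log (2 * n / ‖x K - xstar‖ ^ 2))) ∧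
    -- a prescribed tolerance `ε` is attained, and every run has few iterations
    (∀ ε : ℝ, 0 < ε →
      (∀ x₀ ∈ FCFW.perms n, ∃ (K : ℕ) (x p : ℕ → FCFW.Vec n) (θ : (k : ℕ) → Fin k → ℝ),
        FCFW.IsRun xstar ε K x p θ ∧ x 0 = x₀ ∧ ‖x K - xstar‖ ≤ ε) ∧
      (∀ (K : ℕ) (x p : ℕ → FCFW.Vec n) (θ : (k : ℕ) → Fin k → ℝ),
        FCFW.IsRun xstar ε K x p θ →
          (K : ℝ) ≤ max 1 (8 * (n : ℝ) ^ 3 * Real.log (2 * n / ε ^ 2)))) := by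
  obtain ⟨hruns, htolerances⟩ := mainTheorem5_general n xstar hxstar
  refine ⟨fun tol K x p θ _ h => ⟨(hruns tol K x p θ h).1, fun hpos hone => ?_⟩,
    fun ε hε => ⟨(htolerances ε hε).1, fun K x p θ h => ?_⟩⟩
  · linarith [(hruns tol K x p θ h).2 hpos hone, K.cast_nonneg (α := ℝ)]
  · grind [(htolerances ε hε).2 K x p θ h, K.cast_nonneg (α := ℝ)]
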